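/- Let $p,q\ge 1$ and let $d\mu$ be a $q\times p$ matrix of complex measures on $\mathbb R$ all of whose moments exist (regarded also as a matrix of measures on $\mathbb C$). Let $R(x)=\sum_{k=0}^{N^R}R_kx^k$ ($p\times p$) and $L(x)=\sum_{k=0}^{N^L}L_kx^k$ ($q\times q$) be regular complex matrix polynomials such that, for some $0\le r<p$ and $0\le l<q$, $$R_{N^R}=\begin{bmatrix}0&I_{p-r}\\0&0\end{bmatrix},\quad R_{N^R-1}=\begin{bmatrix}*&*\\I_r&*\end{bmatrix},\qquad L_{N^L}=\begin{bmatrix}0&0\\I_{q-l}&0\end{bmatrix},\quad L_{N^L-1}=\begin{bmatrix}*&I_l\\ *&*\end{bmatrix},$$ with $*$ arbitrary (the conditions on $R_{N^R-1}$ and $L_{N^L-1}$ are void when $N^R=0$, resp. $N^L=0$). Let $d\tilde\mu$ be an Uvarov perturbation of $d\mu$: a $q\times p$ matrix of complex measures on $\mathbb C$, all of whose moments exist, with $d\tilde\mu(x)R(x)=L(x)\,d\mu(x)$. Let $M^R=\deg\det R$ be the number of eigenvalues of $R$ (zeros of $\det R$) counted with multiplicity. For $s\in\{p,q\}$ let $X_{[s]}(x)$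 be the semi-infinite column of blocks $I_s,xI_s,x^2I_s,\dots$. Assume that the moment matrices $\mathscr M=\int X_{[q]}\,d\mu\,X_{[p]}^\top$ and $\tilde{\mathscr M}=\int X_{[q]}\,d\tilde\mu\,X_{[p]}^\top$ have Gauss–Borel factorizations $\mathscr M=S^{-1}H\bar S^{-\top}$ and $\tilde{\mathscr M}=\tilde S^{-1}\tilde H\tilde{\bar S}^{-\top}$, with $S,\bar S,\tilde S,\tilde{\bar S}$ lower unitriangular and $H,\tilde H$ invertible diagonal. Put $$B(x)=SX_{[q]}(x),\quad A(x)=X_{[p]}^\top(x)\bar S^\top H^{-1},\quad D(z)=\int B(x)\frac{d\mu(x)}{z-x},$$ with rows $B_i$, columns $A_i$, rows $D_i$ ($i\ge0$), and $$K^{[n]}(x,y)=\sum_{i=0}^{n}A_i(x)B_i(y),\qquad K_D^{[n]}(x,y)=\sum_{i=0}^{n}A_i(x)D_i(y);$$ objects with a tilde are those attached in the same way to $d\tilde\mu$. Let $\Omega=\tilde S\,L(\Lambda_{[q]})\,S^{-1}$, where $L(\Lambda_{[q]})$ is the block Toeplitz matrix with $(I,J)$ block $L_{J-I}$ (zero unless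 $0\le J-I\le N^L$), and let $\Pi_n$ be the diagonal projection onto the first $n+1$ entries. Then for every $n\ge1$ the commutator $[\Omega,\Pi_{n-1}]$ has only finitely many nonzero entries, and for all $x,y\in\mathbb C$ $$\tilde K^{[n-1]}(x,y)L(y)=R(x)K^{[n-1]}(x,y)-\tilde A(x)[\Omega,\Pi_{n-1}]B(y).$$ If moreover $n\ge M^R$, then for all $x\in\mathbb C$ and all $y\in\mathbb C$ outside the closed supports of $d\mu$ and $d\tilde\mu$ $$\tilde K_D^{[n-1]}(x,y)R(y)=R(x)K_D^{[n-1]}(x,y)-\tilde A(x)[\Omega,\Pi_{n-1}]D(y)+\frac{R(x)-R(y)}{x-y},$$ where the last quotient is read as a polynomial in $x,y$ (so it is $R'(x)$ for $x=y$). -/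

import Mathlib

open scoped Polynomial

noncomputable section

namespace Uvarov

/-! ### Semi-infinite matrices -/

/-- Product of (rectangular) matrices along an index set `ℕ`. It is only used for products all of
whose entries are finite sums. -/
def infMul {m n : Type*} (P : Matrix m ℕ ℂ) (Q : Matrix ℕ n ℂ) : Matrix m n ℂ :=
  Matrix.of fun i j => ∑ᶠ k, P i k * Q k j

/-- Lower triangular semi-infinite matrices with ones on the diagonal. -/
def IsLowerUnitriangular (T : Matrix ℕ ℕ ℂ) : Prop :=
  (∀ i j, i < j → T i j = 0) ∧ ∀ i, T i i = 1

/-- The matrix of monomials `X_[r](x)`, the column of the blocks `I_r, x I_r, x² I_r, …`. -/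
def monomials (r : ℕ) (x : ℂ) : Matrix ℕ (Fin r) ℂ :=
  Matrix.of fun k b => if k % r = (b : ℕ) then x ^ (k / r) else 0

/-- The diagonal projection `Π_n` with ones in its first `n + 1` entries. -/
def proj (n : ℕ) : Matrix ℕ ℕ ℂ := Matrix.diagonal fun i => if i ≤ n then 1 else 0

/-- The commutator `[Ω, P] = Ω P - P Ω`. -/
def commutator (Ω P : Matrix ℕ ℕ ℂ) : Matrix ℕ ℕ ℂ := infMul Ω P - infMul P Ω

/-! ### Matrix polynomials -/

/-- The value `R(x)` of a matrix polynomial. -/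
def evalMat {p : ℕ} (R : Matrix (Fin p) (Fin p) ℂ[X]) (x : ℂ) : Matrix (Fin p) (Fin p) ℂ :=
  R.map fun f => f.eval x

/-- `L(Λ_[q])` where `Λ_[q]` is the block shift: the block upper triangular block Toeplitz matrix
whose `(I, J)` block of size `q` is the coefficient `L_{J - I}` for `I ≤ J`, and zero for
`J < I`. -/
def polyShift {q : ℕ} [NeZero q] (L : Matrix (Fin q) (Fin q) ℂ[X]) : Matrix ℕ ℕ ℂ :=
  Matrix.of fun i j =>
    if i / q ≤ j / q then (L (Fin.ofNat q i) (Fin.ofNat q j)).coeff (j / q - i / q) else 0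

/-- `(R(x) - R(y)) / (x - y)`. As a bivariate matrix polynomial it makes sense on the diagonal
too, where it is `R'(x)`; this is what `dslope` gives. -/
def diffQuot {p : ℕ} (R : Matrix (Fin p) (Fin p) ℂ[X]) (x y : ℂ) : Matrix (Fin p) (Fin p) ℂ :=
  Matrix.of fun a a' => dslope (fun t : ℂ => (R a a').eval t) y x

/-- The number of eigenvalues of `R`, that is, of zeros of `det R`, counted with multiplicity
(so the number of eigenvalues if all of them are simple). -/
def numEigenvalues {p : ℕ} (R : Matrix (Fin p) (Fin p) ℂ[X]) : ℕ := Multiset.card R.det.roots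

/-- A regular `p × p` matrix polynomial `R(x) = ∑_{k ≤ N} R_k x^k` such that
`R_N = [0, I_{p-r}; 0, 0]` and the lower left `r × r` block of `R_{N-1}` is `I_r`,
with `0 ≤ r < p`. -/
structure IsRightPerturber {p : ℕ} (R : Matrix (Fin p) (Fin p) ℂ[X]) (N r : ℕ) : Prop where
  regular : R.det ≠ 0
  lt : r < p
  degree_le : ∀ i j, (R i j).natDegree ≤ N
  leading : ∀ i j, (R i j).coeff N = if (j : ℕ) = i + r then 1 else 0
  subleading : ∀ k, k + 1 = N → ∀ i j : Fin p, p - r ≤ (i : ℕ) → (j : ℕ) < r →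
    (R i j).coeff k = if (i : ℕ) = j + (p - r) then 1 else 0

/-- A regular `q × q` matrix polynomial `L(x) = ∑_{k ≤ N} L_k x^k` such that
`L_N = [0, 0; I_{q-l}, 0]` and the upper right `l × l` block of `L_{N-1}` is `I_l`,
with `0 ≤ l < q`. -/
structure IsLeftPerturber {q : ℕ} (L : Matrix (Fin q) (Fin q) ℂ[X]) (N l : ℕ) : Prop where
  regular : L.det ≠ 0
  lt : l < q
  degree_le : ∀ i j, (L i j).natDegree ≤ N
  leading : ∀ i j, (L i j).coeff N = if (i : ℕ) = j + l then 1 else 0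
  subleading : ∀ k, k + 1 = N → ∀ i j : Fin q, (i : ℕ) < l → q - l ≤ (j : ℕ) →
    (L i j).coeff k = if (j : ℕ) = i + (q - l) then 1 else 0

/-! ### Matrices of measures

A `q × p` matrix of complex measures on `ℂ`. A matrix of measures on the real line is viewed as one
on `ℂ`; perturbed measures may have atoms at non-real points. -/

/-- A matrix of measures on `ℝ`, as a matrix of measures on `ℂ`. -/
def onComplex {p q : ℕ} (μ : Matrix (Fin q) (Fin p) (MeasureTheory.ComplexMeasure ℝ)) :
    Matrix (Fin q) (Fin p) (MeasureTheory.ComplexMeasure ℂ) :=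
  μ.map fun c => c.map (fun t : ℝ => (t : ℂ))

/-- The integral `∫ f dc` of a complex function against a complex measure. -/
def cintegral (f : ℂ → ℂ) (c : MeasureTheory.ComplexMeasure ℂ) : ℂ :=
  c.integral f (ContinuousLinearMap.mul ℝ ℂ)

/-- The complex measure `f dc`. -/
def cdensity (f : ℂ → ℂ) (c : MeasureTheory.ComplexMeasure ℂ) : MeasureTheory.ComplexMeasure ℂ :=
  c.withDensity f (ContinuousLinearMap.mul ℝ ℂ)

section Measures

variable {p q : ℕ}

/-- All the moments of the entries exist (as absolutely convergent integrals). -/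
def HasMoments (μ : Matrix (Fin q) (Fin p) (MeasureTheory.ComplexMeasure ℂ)) : Prop :=
  ∀ b a (k : ℕ), (μ b a).Integrable fun x : ℂ => x ^ k

/-- The support of a matrix of measures: the union of the closed supports of its entries. -/
def matSupport (μ : Matrix (Fin q) (Fin p) (MeasureTheory.ComplexMeasure ℂ)) : Set ℂ :=
  ⋃ b, ⋃ a, (μ b a).variation.support

/-- The moment matrix `∫ X_[q](x) dμ(x) X_[p](x)ᵀ`. -/
def momentMatrix (μ : Matrix (Fin q) (Fin p) (MeasureTheory.ComplexMeasure ℂ)) : Matrix ℕ ℕ ℂ :=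
  Matrix.of fun i j =>
    ∑ b, ∑ a, cintegral (fun x => monomials q x i b * monomials p x j a) (μ b a)

/-- `μt` is an Uvarov perturbation of `μ`: the equality `dμt(x) R(x) = L(x) dμ(x)` of `q × p`
matrices of measures. -/
def IsUvarovPerturbation (μ μt : Matrix (Fin q) (Fin p) (MeasureTheory.ComplexMeasure ℂ))
    (L : Matrix (Fin q) (Fin q) ℂ[X]) (R : Matrix (Fin p) (Fin p) ℂ[X]) : Prop :=
  ∀ b a, ∑ a', cdensity (fun x => (R a' a).eval x) (μt b a') =
    ∑ b', cdensity (fun x => (L b b').eval x) (μ b' a)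

end Measures

/-! ### Gauss–Borel factorization and the attached polynomials and kernels -/

/-- A Gauss–Borel factorization `M = S⁻¹ H S̄⁻ᵀ` with `S`, `S̄` lower unitriangular and
`H = diag h` invertible. -/
structure GaussBorel (M : Matrix ℕ ℕ ℂ) where
  S : Matrix ℕ ℕ ℂ
  Sinv : Matrix ℕ ℕ ℂ
  Sbar : Matrix ℕ ℕ ℂ
  SbarInv : Matrix ℕ ℕ ℂ
  h : ℕ → ℂ
  lower_S : IsLowerUnitriangular S
  lower_Sinv : IsLowerUnitriangular Sinv
  lower_Sbar : IsLowerUnitriangular Sbar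
  lower_SbarInv : IsLowerUnitriangular SbarInv
  S_mul_inv : infMul S Sinv = 1
  inv_mul_S : infMul Sinv S = 1
  Sbar_mul_inv : infMul Sbar SbarInv = 1
  inv_mul_Sbar : infMul SbarInv Sbar = 1
  h_ne_zero : ∀ n, h n ≠ 0
  factor : M = infMul (infMul Sinv (Matrix.diagonal h)) SbarInv.transpose

/-- `B(x) = S X_[q](x)`; its rows are the vector polynomials `B_n(x)`. -/
def GaussBorel.B {M : Matrix ℕ ℕ ℂ} (G : GaussBorel M) (q : ℕ) (x : ℂ) : Matrix ℕ (Fin q) ℂ :=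
  infMul G.S (monomials q x)

/-- `A(x) = X_[p](x)ᵀ S̄ᵀ H⁻¹`; its columns are the vector polynomials `A_n(x)`. -/
def GaussBorel.A {M : Matrix ℕ ℕ ℂ} (G : GaussBorel M) (p : ℕ) (x : ℂ) : Matrix (Fin p) ℕ ℂ :=
  infMul (infMul (monomials p x).transpose G.Sbar.transpose) (Matrix.diagonal fun n => (G.h n)⁻¹)

section Kernels

variable {p q : ℕ}

/-- The Cauchy transform `D(z) = ∫ B(x) dμ(x) / (z - x)`. -/
def cauchyD {μ : Matrix (Fin q) (Fin p) (MeasureTheory.ComplexMeasure ℂ)}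
    (G : GaussBorel (momentMatrix μ)) (z : ℂ) : Matrix ℕ (Fin p) ℂ :=
  Matrix.of fun n a => ∑ b, cintegral (fun x => G.B q x n b / (z - x)) (μ b a)

/-- The Christoffel–Darboux kernel `K^{[n]}(x, y) = ∑_{i=0}^{n} A_i(x) B_i(y)`. -/
def cdKernel {μ : Matrix (Fin q) (Fin p) (MeasureTheory.ComplexMeasure ℂ)}
    (G : GaussBorel (momentMatrix μ)) (n : ℕ) (x y : ℂ) : Matrix (Fin p) (Fin q) ℂ :=
  Matrix.of fun a b => ∑ i ∈ Finset.range (n + 1), G.A p x a i * G.B q y i b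

/-- The mixed-type Christoffel–Darboux kernel `K_D^{[n]}(x, y) = ∑_{i=0}^{n} A_i(x) D_i(y)`. -/
def mixedKernel {μ : Matrix (Fin q) (Fin p) (MeasureTheory.ComplexMeasure ℂ)}
    (G : GaussBorel (momentMatrix μ)) (n : ℕ) (x y : ℂ) : Matrix (Fin p) (Fin p) ℂ :=
  Matrix.of fun a a' => ∑ i ∈ Finset.range (n + 1), G.A p x a i * cauchyD G y i a'

/-- The connection matrix `Ω = S̃ L(Λ_[q]) S⁻¹`. -/
def connection [NeZero q] {M Mt : Matrix ℕ ℕ ℂ} (G : GaussBorel M) (Gt : GaussBorel Mt)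
    (L : Matrix (Fin q) (Fin q) ℂ[X]) : Matrix ℕ ℕ ℂ :=
  infMul (infMul Gt.S (polyShift L)) G.Sinv

end Kernels

end Uvarov

end

noncomputable section

namespace Uvarov

open MeasureTheory Filter Topology

/-! ### Integrals against complex measures -/

/-! The connection matrix Ω admits two readings. By definition it acts on polynomials through the
left perturber: Ω B = S̃ L(Λ) X = S̃ X L = B̃ L (`act_connection_rowB`). The relation dμ̃ R = L dμ
and biorthogonality turn it into Ω H = ∫ B̃ dμ̃ R X_[p]ᵀ S̄ᵀ (`connection_mul_h`); orthogonality
then makes the columns of Ω finite, and the reproducing property gives Ã Ω = R A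
(`A_infMul_connection`). With finite rows and columns every product associates, so Ã [Ω, Π] B = (Ã
Ω) Π B - Ã Π (Ω B) = R K - K̃ L, which is the first formula.

For the second kind functions, insert R(x) = R(z) + (x - z) Q(x) into Ω D(z) = ∫ B̃ dμ̃ R(x) / (z -
x). This gives Ω D = D̃ R(z) - ∫ B̃ dμ̃ Q (`infMul_connection_cauchyD`). The same splitting leaves
the extra term Σ_{i<n} Ã_i ∫ B̃_i dμ̃ Q, which the kernel reproduces as Q(x) once the columns of Q
lie in the span of the first n columns of X_[p]ᵀ. The shape of the leading coefficients of R yields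
M^R ≥ pN - r, so n ≥ M^R suffices (`isBelow_diffQuotCol`).

All the analysis enters through one bilinear `pairing` of polynomial vectors, with weight 1 or 1/(z
- x). -/

lemma cintegral_const_mul (k : ℂ) (f : ℂ → ℂ) (c : ComplexMeasure ℂ) :
    cintegral (fun x => k * f x) c = k * cintegral f c :=
  setToFun_smul _ (fun k s x => by
    simp [VectorMeasure.transpose, mul_left_comm]) k f

lemma cintegral_add {f g : ℂ → ℂ} {c : ComplexMeasure ℂ} (hf : c.Integrable f)
    (hg : c.Integrable g) :
    cintegral (fun x => f x + g x) c = cintegral f c + cintegral g c :=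
  VectorMeasure.integral_fun_add hf hg

lemma variation_cdensity {g : ℂ → ℂ} {c : ComplexMeasure ℂ} (hg : c.Integrable g) :
    (cdensity g c).variation = c.variation.withDensity fun x => ‖g x‖ₑ := by
  have h : ∀ x y : ℂ, ‖ContinuousLinearMap.mul ℝ ℂ x y‖₊ = ‖x‖₊ * ‖y‖₊ := by simp
  rw [cdensity, VectorMeasure.variation_withDensity hg h,
    VectorMeasure.variation_transpose_eq _ _ h]

lemma integrable_cdensity {f g : ℂ → ℂ} {c : ComplexMeasure ℂ} (hf : Measurable f)
    (hg : c.Integrable g) (hgm : Measurable g) (hfg : c.Integrable fun x => f x * g x) :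
    (cdensity g c).Integrable f := by
  rw [VectorMeasure.Integrable, variation_cdensity hg,
    show (fun x => ‖g x‖ₑ) = fun x => ((‖g x‖₊ : NNReal) : ENNReal) from rfl,
    integrable_withDensity_iff_integrable_smul hgm.nnnorm]
  refine hfg.norm.mono' ?_ (Eventually.of_forall fun x => ?_)
  · exact (hgm.nnnorm.smul hf).aestronglyMeasurable
  · simp [NNReal.smul_def, mul_comm]

lemma cintegral_simpleFunc_cdensity {g : ℂ → ℂ} {c : ComplexMeasure ℂ} (hg : c.Integrable g)
    (f : SimpleFunc ℂ ℂ) :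
    cintegral f (cdensity g c) = cintegral (fun x => f x * g x) c := by
  have hfin : IsFiniteMeasure (cdensity g c).variation := by
    rw [variation_cdensity hg]
    exact ⟨by simpa using! hg.2⟩
  have hint : ∀ f : SimpleFunc ℂ ℂ, c.Integrable fun x => f x * g x := fun f => by
    obtain ⟨C, hC⟩ := f.exists_forall_norm_le
    exact hg.bdd_mul f.stronglyMeasurable.aestronglyMeasurable (Eventually.of_forall hC)
  induction f using SimpleFunc.induction with
  | const z hs =>
    rename_i s
    have h1 : (fun x => (SimpleFunc.piecewise s hs (SimpleFunc.const ℂ z)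
        (SimpleFunc.const ℂ 0)) x * g x) = fun x => z * s.indicator g x := by
      ext x
      by_cases hx : x ∈ s <;> simp [hx]
    have h2 : (SimpleFunc.piecewise s hs (SimpleFunc.const ℂ z)
        (SimpleFunc.const ℂ 0) : ℂ → ℂ) = s.indicator (fun _ => z) := by
      ext x
      by_cases hx : x ∈ s <;> simp [hx]
    rw [h1, cintegral_const_mul, h2, cintegral, cintegral,
      VectorMeasure.integral_indicator hs, VectorMeasure.integral_indicator hs]
    have : IsFiniteMeasure ((cdensity g c).restrict s).variation := inferInstance
    rw [VectorMeasure.integral_const, VectorMeasure.restrict_apply _ hs MeasurableSet.univ,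
      Set.univ_inter, cdensity, VectorMeasure.withDensity_apply hg]
    simp
  | add _ h1 h2 =>
    rename_i f1 f2 hd
    have e1 : cintegral (⇑(f1 + f2)) (cdensity g c)
        = cintegral f1 (cdensity g c) + cintegral f2 (cdensity g c) :=
      cintegral_add (SimpleFunc.integrable_of_isFiniteMeasure f1)
        (SimpleFunc.integrable_of_isFiniteMeasure f2)
    rw [e1, h1, h2, ← cintegral_add (hint f1) (hint f2)]
    simp [add_mul]

/-- Simple approximations of `f` can be chosen bounded by 2|f|, so dominated convergence applies on
both sides and reduces to simple functions. -/
lemma cintegral_cdensity {f g : ℂ → ℂ} {c : ComplexMeasure ℂ} (hf : Measurable f)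
    (hg : c.Integrable g) (hgm : Measurable g) (hfg : c.Integrable fun x => f x * g x) :
    cintegral f (cdensity g c) = cintegral (fun x => f x * g x) c := by
  let F : ℕ → SimpleFunc ℂ ℂ := SimpleFunc.approxOn f hf Set.univ 0 (Set.mem_univ _)
  have hF : ∀ n x, ‖F n x‖ ≤ 2 * ‖f x‖ := fun n x => by
    rw [two_mul]
    exact SimpleFunc.norm_approxOn_zero_le hf (Set.mem_univ _) x n
  have hlim : ∀ x, Tendsto (fun n => F n x) atTop (𝓝 (f x)) := fun x =>
    SimpleFunc.tendsto_approxOn hf (Set.mem_univ _) (by simp)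
  have hl : Tendsto (fun n => cintegral (F n) (cdensity g c)) atTop
      (𝓝 (cintegral f (cdensity g c))) :=
    VectorMeasure.tendsto_integral_of_dominated_convergence (fun x => 2 * ‖f x‖)
      (fun n => (F n).stronglyMeasurable.aestronglyMeasurable)
      ((integrable_cdensity hf hg hgm hfg).norm.const_mul 2)
      (fun n => Eventually.of_forall (hF n)) (Eventually.of_forall hlim)
  have hr : Tendsto (fun n => cintegral (fun x => F n x * g x) c) atTop
      (𝓝 (cintegral (fun x => f x * g x) c)) :=
    VectorMeasure.tendsto_integral_of_dominated_convergence (fun x => 2 * ‖f x * g x‖)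
      (fun n => ((F n).measurable.mul hgm).aestronglyMeasurable)
      (hfg.norm.const_mul 2)
      (fun n => Eventually.of_forall fun x => by
        rw [norm_mul, norm_mul, ← mul_assoc]
        exact mul_le_mul_of_nonneg_right (hF n x) (norm_nonneg _))
      (Eventually.of_forall fun x => (hlim x).mul_const (g x))
  refine tendsto_nhds_unique hl (hr.congr fun n => ?_)
  exact (cintegral_simpleFunc_cdensity hg (F n)).symm

/-- Makes the Cauchy kernel essentially bounded off the support, hence an admissible weight. -/
lemma ae_dist_ge_of_notMem_support {c : ComplexMeasure ℂ} {z : ℂ}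
    (hz : z ∉ c.variation.support) : ∃ ε > 0, ∀ᵐ x ∂c.variation, ε ≤ ‖z - x‖ := by
  obtain ⟨U, hU, h0⟩ := Measure.notMem_support_iff_exists.1 hz
  obtain ⟨ε, hε, hball⟩ := Metric.mem_nhds_iff.1 hU
  refine ⟨ε, hε, ?_⟩
  filter_upwards [measure_eq_zero_iff_ae_notMem.1 h0] with x hx
  by_contra h
  refine hx (hball ?_)
  rw [Metric.mem_ball, dist_comm, dist_eq_norm]
  exact lt_of_not_ge h

/-! ### The pairing of polynomial vectors defined by a matrix of measures -/

section Pairing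

variable {p q : ℕ}

/-- The weight `φ` is measurable, and all polynomials times `φ` are integrable against the entries
of `μ`. -/
structure IsWeight (μ : Matrix (Fin q) (Fin p) (ComplexMeasure ℂ)) (φ : ℂ → ℂ) : Prop where
  measurable : Measurable φ
  integrable : ∀ b a (P : ℂ[X]), (μ b a).Integrable fun x => P.eval x * φ x

lemma integrable_eval {μ : Matrix (Fin q) (Fin p) (ComplexMeasure ℂ)} (hμ : HasMoments μ)
    (b : Fin q) (a : Fin p) (P : ℂ[X]) : (μ b a).Integrable fun x => P.eval x := by
  simp only [Polynomial.eval_eq_sum, Polynomial.sum]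
  exact integrable_finsetSum _ fun k _ => (hμ b a k).const_mul _

lemma isWeight_one {μ : Matrix (Fin q) (Fin p) (ComplexMeasure ℂ)} (hμ : HasMoments μ) :
    IsWeight μ fun _ => 1 :=
  ⟨measurable_const, fun b a P => by simpa using! integrable_eval hμ b a P⟩

lemma notMem_support_of_notMem_matSupport {μ : Matrix (Fin q) (Fin p) (ComplexMeasure ℂ)} {z : ℂ}
    (hz : z ∉ matSupport μ) (b : Fin q) (a : Fin p) : z ∉ (μ b a).variation.support := by
  simp only [matSupport, Set.mem_iUnion, not_exists] at hz
  exact hz b a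

lemma isWeight_cauchy {μ : Matrix (Fin q) (Fin p) (ComplexMeasure ℂ)} (hμ : HasMoments μ) {z : ℂ}
    (hz : z ∉ matSupport μ) : IsWeight μ fun x => (z - x)⁻¹ where
  measurable := (measurable_const.sub measurable_id).inv
  integrable b a P := by
    obtain ⟨ε, hε, h⟩ := ae_dist_ge_of_notMem_support (notMem_support_of_notMem_matSupport hz b a)
    refine (integrable_eval hμ b a P).mul_bdd (c := ε⁻¹)
      (measurable_const.sub measurable_id).inv.aestronglyMeasurable ?_
    filter_upwards [h] with x hx
    rw [norm_inv]
    exact inv_anti₀ hε hx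

/-- The functional `P ↦ ∫ P φ dμ_{ba}`. -/
def functional {μ : Matrix (Fin q) (Fin p) (ComplexMeasure ℂ)} {φ : ℂ → ℂ} (h : IsWeight μ φ)
    (b : Fin q) (a : Fin p) : ℂ[X] →ₗ[ℂ] ℂ where
  toFun P := cintegral (fun x => P.eval x * φ x) (μ b a)
  map_add' P Q := by
    rw [← cintegral_add (h.integrable b a P) (h.integrable b a Q)]
    simp [add_mul]
  map_smul' k P := by
    rw [RingHom.id_apply, smul_eq_mul, ← cintegral_const_mul]
    simp [mul_assoc]

lemma functional_apply {μ : Matrix (Fin q) (Fin p) (ComplexMeasure ℂ)} {φ : ℂ → ℂ}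
    (h : IsWeight μ φ) (b : Fin q) (a : Fin p) (P : ℂ[X]) :
    functional h b a P = cintegral (fun x => P.eval x * φ x) (μ b a) := rfl

/-- The pairing `∫ U dμ V φ` of polynomial vectors. -/
def pairing {μ : Matrix (Fin q) (Fin p) (ComplexMeasure ℂ)} {φ : ℂ → ℂ} (h : IsWeight μ φ) :
    (Fin q → ℂ[X]) →ₗ[ℂ] (Fin p → ℂ[X]) →ₗ[ℂ] ℂ :=
  LinearMap.mk₂ ℂ (fun U V => ∑ b, ∑ a, functional h b a (U b * V a))
    (fun U U' V => by simp [add_mul, Finset.sum_add_distrib])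
    (fun k U V => by simp [Finset.mul_sum])
    (fun U V V' => by simp [mul_add, Finset.sum_add_distrib])
    (fun k U V => by simp [Finset.mul_sum])

lemma pairing_apply {μ : Matrix (Fin q) (Fin p) (ComplexMeasure ℂ)} {φ : ℂ → ℂ}
    (h : IsWeight μ φ) (U : Fin q → ℂ[X]) (V : Fin p → ℂ[X]) :
    pairing h U V = ∑ b, ∑ a, functional h b a (U b * V a) := rfl

lemma functional_perturbation {μ μt : Matrix (Fin q) (Fin p) (ComplexMeasure ℂ)}
    {L : Matrix (Fin q) (Fin q) ℂ[X]} {R : Matrix (Fin p) (Fin p) ℂ[X]}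
    (hμ : HasMoments μ) (hμt : HasMoments μt) (hpert : IsUvarovPerturbation μ μt L R) {φ : ℂ → ℂ}
    (h : IsWeight μ φ) (ht : IsWeight μt φ) (b : Fin q) (a : Fin p) (P : ℂ[X]) :
    ∑ a', functional ht b a' (P * R a' a) = ∑ b', functional h b' a (P * L b b') := by
  have hm : Measurable fun x => P.eval x * φ x := P.continuous.measurable.mul h.measurable
  have key : ∀ {ν : Matrix (Fin q) (Fin p) (ComplexMeasure ℂ)} (hν : HasMoments ν)
      (w : IsWeight ν φ) (b : Fin q) (a : Fin p) (Q : ℂ[X]),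
      functional w b a (P * Q) =
        cintegral (fun x => P.eval x * φ x) (cdensity (fun x => Q.eval x) (ν b a)) ∧
      (cdensity (fun x => Q.eval x) (ν b a)).Integrable fun x => P.eval x * φ x := by
    intro ν hν w b a Q
    have e : (fun x => P.eval x * φ x * Q.eval x) = fun x => (P * Q).eval x * φ x := by
      ext x
      rw [Polynomial.eval_mul]
      ring
    have hi : (ν b a).Integrable fun x => P.eval x * φ x * Q.eval x := by
      rw [e]
      exact w.integrable b a (P * Q)
    refine ⟨?_, integrable_cdensity hm (integrable_eval hν b a Q) Q.continuous.measurable hi⟩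
    rw [cintegral_cdensity hm (integrable_eval hν b a Q) Q.continuous.measurable hi, e, functional_apply]
  rw [Finset.sum_congr rfl fun a' _ => (key hμt ht b a' (R a' a)).1,
    Finset.sum_congr rfl fun b' _ => (key hμ h b' a (L b b')).1]
  have e1 := VectorMeasure.integral_finsetSum_vectorMeasure (B := ContinuousLinearMap.mul ℝ ℂ)
    (s := Finset.univ) fun a' _ => (key hμt ht b a' (R a' a)).2
  have e2 := VectorMeasure.integral_finsetSum_vectorMeasure (B := ContinuousLinearMap.mul ℝ ℂ)
    (s := Finset.univ) fun b' _ => (key hμ h b' a (L b b')).2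
  rw [hpert b a] at e1
  exact e1.symm.trans e2

/-- An Uvarov perturbation moves `R` to `L` through the pairing. -/
lemma pairing_perturbation {μ μt : Matrix (Fin q) (Fin p) (ComplexMeasure ℂ)}
    {L : Matrix (Fin q) (Fin q) ℂ[X]} {R : Matrix (Fin p) (Fin p) ℂ[X]}
    (hμ : HasMoments μ) (hμt : HasMoments μt) (hpert : IsUvarovPerturbation μ μt L R) {φ : ℂ → ℂ}
    (h : IsWeight μ φ) (ht : IsWeight μt φ) (U : Fin q → ℂ[X]) (V : Fin p → ℂ[X]) :
    pairing ht U (R.mulVec V) = pairing h (Matrix.vecMul U L) V := by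
  have e : ∀ b a, ∑ a', functional ht b a' (U b * (R a' a * V a)) =
      ∑ b', functional h b' a (U b * L b b' * V a) := fun b a => by
    have := functional_perturbation hμ hμt hpert h ht b a (U b * V a)
    simpa only [mul_right_comm (U b) (V a), mul_assoc] using this
  simp only [pairing_apply, Matrix.mulVec, Matrix.vecMul, dotProduct, Finset.mul_sum,
    Finset.sum_mul, map_sum]
  calc _ = ∑ b, ∑ a, ∑ a', functional ht b a' (U b * (R a' a * V a)) :=
        Finset.sum_congr rfl fun b _ => Finset.sum_comm
    _ = ∑ b, ∑ a, ∑ b', functional h b' a (U b * L b b' * V a) := by simp only [e]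
    _ = ∑ b, ∑ b', ∑ a, functional h b' a (U b * L b b' * V a) :=
        Finset.sum_congr rfl fun b _ => Finset.sum_comm
    _ = ∑ b', ∑ b, ∑ a, functional h b' a (U b * L b b' * V a) := Finset.sum_comm
    _ = _ := Finset.sum_congr rfl fun b _ => Finset.sum_comm

/-- Multiplication by `z - x` removes the Cauchy kernel from the pairing. -/
lemma pairing_cauchy_smul {μ : Matrix (Fin q) (Fin p) (ComplexMeasure ℂ)} (hμ : HasMoments μ)
    {z : ℂ} (hz : z ∉ matSupport μ) (U : Fin q → ℂ[X]) (V : Fin p → ℂ[X]) :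
    pairing (isWeight_cauchy hμ hz) U (fun a => (Polynomial.C z - Polynomial.X) * V a) =
      pairing (isWeight_one hμ) U V := by
  simp only [pairing_apply, functional_apply]
  refine Finset.sum_congr rfl fun b _ => Finset.sum_congr rfl fun a _ => ?_
  obtain ⟨ε, hε, h⟩ := ae_dist_ge_of_notMem_support (notMem_support_of_notMem_matSupport hz b a)
  refine VectorMeasure.integral_congr_ae ?_
  -- The factor cancels only where x ≠ z, which holds almost everywhere since z is off the support.
  filter_upwards [h] with x hx
  have hne : z - x ≠ 0 := norm_pos_iff.1 (hε.trans_le hx)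
  simp only [Polynomial.eval_mul, Polynomial.eval_sub, Polynomial.eval_C, Polynomial.eval_X]
  field_simp

end Pairing

/-! ### Row-finite semi-infinite matrices and their action -/

/-- All rows have finite support. -/
def RowFinite (P : Matrix ℕ ℕ ℂ) : Prop := ∀ i, (Function.support (P i)).Finite

lemma IsLowerUnitriangular.rowFinite {T : Matrix ℕ ℕ ℂ} (hT : IsLowerUnitriangular T) :
    RowFinite T := fun i =>
  (Set.finite_Iic i).subset fun j hj => by
    by_contra h
    exact hj (hT.1 i j (not_le.1 h))

section Action

variable {W W' : Type*} [AddCommGroup W] [Module ℂ W] [AddCommGroup W'] [Module ℂ W']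

/-- The sequence `i ↦ ∑ k, P i k • v k`. -/
def act (P : Matrix ℕ ℕ ℂ) (v : ℕ → W) (i : ℕ) : W := ∑ᶠ k, P i k • v k

lemma RowFinite.support_smul {P : Matrix ℕ ℕ ℂ} (hP : RowFinite P) (v : ℕ → W) (i : ℕ) :
    (Function.support fun k => P i k • v k).Finite :=
  (hP i).subset fun k hk h => hk (by simp [h])

lemma act_eq_sum {P : Matrix ℕ ℕ ℂ} {i : ℕ} {s : Finset ℕ} (hs : ∀ k, k ∉ s → P i k = 0)
    (v : ℕ → W) : act P v i = ∑ k ∈ s, P i k • v k :=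
  finsum_eq_sum_of_support_subset _ fun k hk => by
    by_contra h
    exact hk (by simp [hs k h])

lemma infMul_eq_act (P Q : Matrix ℕ ℕ ℂ) (i j : ℕ) : infMul P Q i j = act P (fun k => Q k j) i :=
  rfl

lemma map_act (f : W →ₗ[ℂ] W') {P : Matrix ℕ ℕ ℂ} (hP : RowFinite P) (v : ℕ → W) (i : ℕ) :
    f (act P v i) = act P (fun k => f (v k)) i := by
  rw [act, map_finsum f (hP.support_smul v i)]
  simp [act]

lemma act_one (v : ℕ → W) : act 1 v = v := by
  ext i
  rw [act, finsum_eq_single _ i fun k hk => by simp [Matrix.one_apply_ne hk.symm]]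
  simp

lemma RowFinite.infMul {P Q : Matrix ℕ ℕ ℂ} (hP : RowFinite P) (hQ : RowFinite Q) :
    RowFinite (infMul P Q) := fun i => by
  refine ((hP i).biUnion fun k _ => hQ k).subset fun l hl => ?_
  by_contra h
  refine hl (finsum_eq_zero_of_forall_eq_zero fun k => ?_)
  by_contra hk
  exact h (Set.mem_biUnion (left_ne_zero_of_mul hk) (right_ne_zero_of_mul hk))

/-- Associativity can fail for semi-infinite matrices; finite rows make the double sum finite, so
its order can be exchanged. -/
lemma act_infMul {P Q : Matrix ℕ ℕ ℂ} (hP : RowFinite P) (hQ : RowFinite Q) (v : ℕ → W) :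
    act (infMul P Q) v = act P (act Q v) := by
  ext i
  classical
  set s := (hP i).toFinset with hs
  have hs' : ∀ k, k ∉ s → P i k = 0 := fun k hk => by simpa [hs] using hk
  set t := s.biUnion fun k => (hQ k).toFinset with ht
  have ht' : ∀ k ∈ s, ∀ l, l ∉ t → Q k l = 0 := fun k hk l hl => by
    by_contra h
    exact hl (Finset.mem_biUnion.2 ⟨k, hk, by simpa using h⟩)
  have e : ∀ l, infMul P Q i l = ∑ k ∈ s, P i k * Q k l := fun l => act_eq_sum hs' _
  have h1 : act (infMul P Q) v i = ∑ l ∈ t, infMul P Q i l • v l := act_eq_sum (fun l hl => by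
    rw [e]
    exact Finset.sum_eq_zero fun k hk => by rw [ht' k hk l hl, mul_zero]) v
  have h2 : act P (act Q v) i = ∑ k ∈ s, P i k • ∑ l ∈ t, Q k l • v l := by
    rw [act_eq_sum hs']
    exact Finset.sum_congr rfl fun k hk => by rw [act_eq_sum (ht' k hk)]
  rw [h1, h2]
  simp only [e, Finset.sum_smul, Finset.smul_sum, mul_smul]
  exact Finset.sum_comm

end Action

lemma infMul_diagonal {m : Type*} (P : Matrix m ℕ ℂ) (d : ℕ → ℂ) (i : m) (j : ℕ) :
    infMul P (Matrix.diagonal d) i j = P i j * d j := by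
  simp only [infMul, Matrix.of_apply]
  rw [finsum_eq_single _ j fun k hk => by simp [Matrix.diagonal_apply_ne _ hk]]
  simp

lemma diagonal_infMul {m : Type*} (P : Matrix ℕ m ℂ) (d : ℕ → ℂ) (i : ℕ) (j : m) :
    infMul (Matrix.diagonal d) P i j = d i * P i j := by
  simp only [infMul, Matrix.of_apply]
  rw [finsum_eq_single _ i fun k hk => by simp [Matrix.diagonal_apply_ne' _ hk]]
  simp

lemma commutator_proj_apply (Ω : Matrix ℕ ℕ ℂ) {n : ℕ} (hn : 1 ≤ n) (i j : ℕ) :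
    commutator Ω (proj (n - 1)) i j =
      Ω i j * (if j < n then 1 else 0) - (if i < n then 1 else 0) * Ω i j := by
  rw [commutator, proj, Matrix.sub_apply, infMul_diagonal, diagonal_infMul]
  simp only [Nat.le_sub_one_iff_lt hn]

/-- A nonzero entry has exactly one index below n: finite rows bound one corner, finite columns the
other. -/
lemma commutator_proj_finite {Ω : Matrix ℕ ℕ ℂ} (hr : RowFinite Ω)
    (hc : RowFinite Ω.transpose) {n : ℕ} (hn : 1 ≤ n) :
    {ij : ℕ × ℕ | commutator Ω (proj (n - 1)) ij.1 ij.2 ≠ 0}.Finite := by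
  have h1 : (⋃ i ∈ Set.Iio n, (Prod.mk i) '' (Function.support (Ω i))).Finite :=
    (Set.finite_Iio n).biUnion fun i _ => (hr i).image _
  have h2 : (⋃ j ∈ Set.Iio n, (fun i => (i, j)) '' (Function.support (Ω.transpose j))).Finite :=
    (Set.finite_Iio n).biUnion fun j _ => (hc j).image _
  refine (h1.union h2).subset ?_
  rintro ⟨i, j⟩ hij
  rw [Set.mem_ofPred_eq, commutator_proj_apply Ω hn] at hij
  have h0 : Ω i j ≠ 0 := fun h => hij (by simp [h])
  by_cases hi : i < n
  · exact Or.inl (Set.mem_biUnion hi ⟨j, h0, rfl⟩)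
  · by_cases hj : j < n
    · exact Or.inr (Set.mem_biUnion hj ⟨i, h0, rfl⟩)
    · simp [hi, hj] at hij

/-- The finite-rank bilinear expression defined by the commutator with a projection. -/
lemma finsum_commutator_proj {Ω : Matrix ℕ ℕ ℂ} (hr : RowFinite Ω)
    (hc : RowFinite Ω.transpose) {n : ℕ} (hn : 1 ≤ n) (α β : ℕ → ℂ) :
    ∑ᶠ l, (∑ᶠ k, α k * commutator Ω (proj (n - 1)) k l) * β l =
      ∑ l ∈ Finset.range n, (∑ᶠ k, α k * Ω k l) * β l -
        ∑ k ∈ Finset.range n, α k * ∑ᶠ l, Ω k l * β l := by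
  -- A `finsum` with infinite support is 0 by convention, so each splitting below needs finite
  -- support: from the columns of Ω for sums over k, from its rows for sums over l.
  have hfin : ∀ l, (Function.support fun k => α k * Ω k l).Finite := fun l =>
    (hc l).subset fun k hk => right_ne_zero_of_mul hk
  have e1 : ∀ l, ∑ᶠ k, α k * commutator Ω (proj (n - 1)) k l =
      (∑ᶠ k, α k * Ω k l) * (if l < n then 1 else 0) - ∑ k ∈ Finset.range n, α k * Ω k l := by
    intro l
    have h2 : ∑ k ∈ Finset.range n, α k * Ω k l =
        ∑ᶠ k, (if k < n then 1 else 0) * (α k * Ω k l) := by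
      rw [finsum_eq_sum_of_support_subset (s := Finset.range n) _ fun k hk => by
        by_contra h
        exact hk (by simp_all)]
      exact Finset.sum_congr rfl fun k hk => by simp [Finset.mem_range.1 hk]
    rw [h2, finsum_mul' _ _ (hfin l), ← finsum_sub_distrib]
    · refine finsum_congr fun k => ?_
      rw [commutator_proj_apply Ω hn]
      ring
    · exact (hfin l).subset fun k hk => left_ne_zero_of_mul hk
    · exact (hfin l).subset fun k hk => right_ne_zero_of_mul hk
  have hfin' : ∀ k, (Function.support fun l => Ω k l * β l).Finite := fun k =>
    (hr k).subset fun l hl => left_ne_zero_of_mul hl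
  have h3 : ∑ k ∈ Finset.range n, α k * ∑ᶠ l, Ω k l * β l =
      ∑ᶠ l, (∑ k ∈ Finset.range n, α k * Ω k l) * β l := by
    simp only [Finset.sum_mul]
    rw [finsum_sum_comm]
    · refine Finset.sum_congr rfl fun k _ => ?_
      rw [mul_finsum' _ _ (hfin' k)]
      simp only [mul_assoc]
    · exact fun k _ => (hfin' k).subset fun l hl h => hl (by simp [mul_assoc, h])
  have h4 : ∑ l ∈ Finset.range n, (∑ᶠ k, α k * Ω k l) * β l =
      ∑ᶠ l, (∑ᶠ k, α k * Ω k l) * (if l < n then 1 else 0) * β l := by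
    rw [finsum_eq_sum_of_support_subset (s := Finset.range n) _ fun k hk => by
      by_contra h
      exact hk (by simp_all)]
    exact Finset.sum_congr rfl fun k hk => by simp [Finset.mem_range.1 hk]
  rw [h3, h4, ← finsum_sub_distrib]
  · refine finsum_congr fun l => ?_
    rw [e1]
    ring
  · exact (Set.finite_Iio n).subset fun l hl => by
      by_contra h
      exact hl (by simp_all)
  · refine ((Set.finite_Iio n).biUnion fun k _ => hfin' k).subset fun l hl => ?_
    have hl' : ∑ k ∈ Finset.range n, α k * Ω k l * β l ≠ 0 := by
      rw [← Finset.sum_mul]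
      exact hl
    obtain ⟨k, hk, h⟩ := Finset.exists_ne_zero_of_sum_ne_zero hl'
    exact Set.mem_biUnion (Finset.mem_range.1 hk)
      (right_ne_zero_of_mul (by rwa [mul_assoc] at h))

/-! ### Vectors of monomials -/

section Monomials

variable {r : ℕ}

/-- The rows of `X_[r]` as vectors of polynomials. -/
def monomialRow (r k : ℕ) : Fin r → ℂ[X] :=
  fun b => if k % r = (b : ℕ) then Polynomial.X ^ (k / r) else 0

lemma eval_monomialRow (k : ℕ) (b : Fin r) (x : ℂ) :
    (monomialRow r k b).eval x = monomials r x k b := by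
  simp only [monomialRow, monomials, Matrix.of_apply]
  split_ifs <;> simp

/-- Evaluation of a vector of polynomials at an entry. -/
def evalEntry (b : Fin r) (x : ℂ) : (Fin r → ℂ[X]) →ₗ[ℂ] ℂ :=
  (Polynomial.leval x).comp (LinearMap.proj b)

lemma evalEntry_apply (b : Fin r) (x : ℂ) (V : Fin r → ℂ[X]) : evalEntry b x V = (V b).eval x :=
  rfl

lemma index_mod (j : ℕ) (a : Fin r) : (j * r + a) % r = a := by
  rw [mul_comm, Nat.mul_add_mod, Nat.mod_eq_of_lt a.isLt]

lemma index_div (j : ℕ) (a : Fin r) : (j * r + a) / r = j := by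
  have : 0 < r := a.pos
  rw [mul_comm, Nat.mul_add_div this, Nat.div_eq_of_lt a.isLt, add_zero]

/-- Position k of X_[r] carries degree k / r in component k % r, so degree j of component a sits at
position j * r + a. -/
lemma eq_sum_monomialRow (V : Fin r → ℂ[X]) :
    V = ∑ a, ∑ j ∈ (V a).support, (V a).coeff j • monomialRow r (j * r + a) := by
  ext b : 1
  rw [Finset.sum_apply, Finset.sum_eq_single b]
  · rw [Finset.sum_apply]
    nth_rewrite 1 [(V b).as_sum_support]
    exact Finset.sum_congr rfl fun j _ => by
      simp only [Pi.smul_apply, monomialRow, index_mod, index_div, if_true,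
        Polynomial.smul_X_eq_monomial]
  · intro a _ hab
    rw [Finset.sum_apply]
    exact Finset.sum_eq_zero fun j _ => by
      simp only [Pi.smul_apply, monomialRow, index_mod, Fin.val_ne_of_ne hab, if_false, smul_zero]
  · simp

variable [NeZero r]

lemma polyShift_rowFinite (L : Matrix (Fin r) (Fin r) ℂ[X]) : RowFinite (polyShift L) := by
  intro i
  refine (Set.finite_iUnion fun b : Fin r => ((L (Fin.ofNat r i) b).support.finite_toSet.image
    fun j => (i / r + j) * r + b)).subset fun k hk => ?_
  simp only [Function.mem_support, polyShift, Matrix.of_apply, ne_eq, ite_eq_right_iff,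
    Classical.not_imp] at hk
  refine Set.mem_iUnion.2 ⟨Fin.ofNat r k, k / r - i / r, ?_, ?_⟩
  · simpa using hk.2
  · simp only [Fin.val_ofNat, Nat.add_sub_cancel' hk.1]
    exact Nat.div_add_mod' k r

/-- The identity L(Λ) X = X L, checked on the coefficient of x^k in component b, to which only
position k * r + b contributes. -/
lemma act_polyShift (L : Matrix (Fin r) (Fin r) ℂ[X]) (i : ℕ) :
    act (polyShift L) (monomialRow r) i = Matrix.vecMul (monomialRow r i) L := by
  have hL : Matrix.vecMul (monomialRow r i) L =
      fun b => Polynomial.X ^ (i / r) * L (Fin.ofNat r i) b := by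
    ext1 b
    rw [Matrix.vecMul, dotProduct, Finset.sum_eq_single (Fin.ofNat r i)]
    · simp [monomialRow]
    · intro c _ hc
      have : i % r ≠ c := fun h => hc (by ext; simp [h])
      simp [monomialRow, this]
    · simp
  ext1 b
  have h1 := map_act (LinearMap.proj b : (Fin r → ℂ[X]) →ₗ[ℂ] ℂ[X]) (polyShift_rowFinite L)
    (monomialRow r) i
  simp only [LinearMap.proj_apply] at h1
  rw [h1, hL]
  ext k
  have h2 := map_act (Polynomial.lcoeff ℂ k) (polyShift_rowFinite L)
    (fun m => monomialRow r m b) i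
  simp only [Polynomial.lcoeff_apply] at h2
  rw [h2, act, finsum_eq_single _ (k * r + b)]
  · have hof : Fin.ofNat r (k * r + b) = b := by
      ext
      simp only [Fin.val_ofNat, index_mod]
    simp only [monomialRow, index_mod, index_div, if_true, polyShift, Matrix.of_apply, hof,
      Polynomial.coeff_X_pow_self, smul_eq_mul, mul_one, Polynomial.coeff_X_pow_mul']
  · intro m hm
    by_cases h : m % r = b
    · have hk : k ≠ m / r := fun hk => hm (by rw [hk, ← h, Nat.div_add_mod'])
      simp [monomialRow, h, Polynomial.coeff_X_pow, hk]
    · simp [monomialRow, h]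

end Monomials

/-! ### Biorthogonality and the reproducing property -/

section GaussBorel

variable {p q : ℕ} {M : Matrix ℕ ℕ ℂ}

/-- The rows of `B` as vectors of polynomials. -/
def GaussBorel.rowB (G : GaussBorel M) (q : ℕ) : ℕ → Fin q → ℂ[X] := act G.S (monomialRow q)

/-- The columns of `A H` as vectors of polynomials. -/
def GaussBorel.colA (G : GaussBorel M) (p : ℕ) : ℕ → Fin p → ℂ[X] := act G.Sbar (monomialRow p)

lemma GaussBorel.B_apply (G : GaussBorel M) (x : ℂ) (i : ℕ) (b : Fin q) :
    G.B q x i b = (G.rowB q i b).eval x := by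
  rw [← evalEntry_apply, rowB, map_act _ G.lower_S.rowFinite]
  simp only [evalEntry_apply, eval_monomialRow]
  rfl

lemma GaussBorel.A_apply (G : GaussBorel M) (x : ℂ) (a : Fin p) (i : ℕ) :
    G.A p x a i = (G.h i)⁻¹ * (G.colA p i a).eval x := by
  rw [← evalEntry_apply, colA, map_act _ G.lower_Sbar.rowFinite, A, infMul_diagonal, mul_comm]
  simp only [evalEntry_apply, eval_monomialRow]
  simp only [infMul, act, Matrix.of_apply, Matrix.transpose_apply, smul_eq_mul, mul_comm]

lemma GaussBorel.act_SbarInv_colA (G : GaussBorel M) :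
    act G.SbarInv (G.colA p) = monomialRow p := by
  rw [colA, ← act_infMul G.lower_SbarInv.rowFinite G.lower_Sbar.rowFinite, G.inv_mul_Sbar, act_one]

lemma GaussBorel.act_Sinv_rowB (G : GaussBorel M) : act G.Sinv (G.rowB q) = monomialRow q := by
  rw [rowB, ← act_infMul G.lower_Sinv.rowFinite G.lower_S.rowFinite, G.inv_mul_S, act_one]

variable {μ : Matrix (Fin q) (Fin p) (ComplexMeasure ℂ)}

lemma momentMatrix_apply (hμ : HasMoments μ) (i j : ℕ) :
    momentMatrix μ i j = pairing (isWeight_one hμ) (monomialRow q i) (monomialRow p j) := by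
  simp [momentMatrix, pairing_apply, functional_apply, eval_monomialRow]

/-- This is S M = H S̄⁻ᵀ, read one column of M at a time so that only row-finite matrices are
composed. -/
lemma pairing_rowB_monomialRow (hμ : HasMoments μ) (G : GaussBorel (momentMatrix μ)) (i j : ℕ) :
    pairing (isWeight_one hμ) (G.rowB q i) (monomialRow p j) = G.h i * G.SbarInv j i := by
  have h1 : (fun k => momentMatrix μ k j) = act G.Sinv fun k => G.h k * G.SbarInv j k := by
    ext k
    conv_lhs => rw [G.factor]
    rw [act]
    simp only [infMul, Matrix.of_apply]
    refine finsum_congr fun l => ?_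
    have := infMul_diagonal G.Sinv G.h k l
    simp only [infMul, Matrix.of_apply] at this
    rw [this, Matrix.transpose_apply, smul_eq_mul, mul_assoc]
  have h2 := map_act ((pairing (isWeight_one hμ)).flip (monomialRow p j)) G.lower_S.rowFinite
    (monomialRow q) i
  simp only [LinearMap.flip_apply, ← momentMatrix_apply hμ] at h2
  rw [GaussBorel.rowB, h2, h1, ← act_infMul G.lower_S.rowFinite G.lower_Sinv.rowFinite,
    G.S_mul_inv, act_one]

/-- Biorthogonality. `colA` omits the factor H⁻¹ of A, hence the value h_k instead of 1. -/
lemma pairing_rowB_colA (hμ : HasMoments μ) (G : GaussBorel (momentMatrix μ)) (i k : ℕ) :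
    pairing (isWeight_one hμ) (G.rowB q i) (G.colA p k) = if i = k then G.h k else 0 := by
  rw [GaussBorel.colA, map_act _ G.lower_Sbar.rowFinite]
  simp only [pairing_rowB_monomialRow hμ]
  have h : act G.Sbar (fun j => G.h i * G.SbarInv j i) k =
      G.h i * infMul G.Sbar G.SbarInv k i := by
    rw [infMul_eq_act]
    exact (map_act (LinearMap.lsmul ℂ ℂ (G.h i)) G.lower_Sbar.rowFinite
      (fun j => G.SbarInv j i) k).symm
  rw [h, G.Sbar_mul_inv]
  by_cases hik : i = k
  · rw [hik, Matrix.one_apply_eq, if_pos rfl, mul_one]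
  · rw [Matrix.one_apply_ne (Ne.symm hik), if_neg hik, mul_zero]

/-- The vector of polynomials `V` is a combination of the first `n` columns of `X_[p]ᵀ`. -/
def IsBelow (n : ℕ) (V : Fin p → ℂ[X]) : Prop := ∀ a j, (V a).coeff j ≠ 0 → j * p + a < n

lemma exists_isBelow (V : Fin p → ℂ[X]) : ∃ n, IsBelow n V := by
  refine ⟨(Finset.univ.sup (fun a => (V a).natDegree) + 1) * p, fun a j h => ?_⟩
  have h1 : j ≤ Finset.univ.sup fun a => (V a).natDegree :=
    (Polynomial.le_natDegree_of_ne_zero h).trans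
      (Finset.le_sup (f := fun a => (V a).natDegree) (Finset.mem_univ a))
  calc j * p + a < j * p + p := by gcongr; exact a.isLt
    _ = (j + 1) * p := by ring
    _ ≤ _ := by gcongr

lemma pairing_rowB_eq_zero (hμ : HasMoments μ) (G : GaussBorel (momentMatrix μ)) {n : ℕ}
    {V : Fin p → ℂ[X]} (hV : IsBelow n V) {i : ℕ} (hi : n ≤ i) :
    pairing (isWeight_one hμ) (G.rowB q i) V = 0 := by
  rw [eq_sum_monomialRow V, map_sum]
  refine Finset.sum_eq_zero fun a _ => ?_
  rw [map_sum]
  refine Finset.sum_eq_zero fun j hj => ?_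
  rw [map_smul, pairing_rowB_monomialRow hμ, G.lower_SbarInv.1 _ _
    ((hV a j (Polynomial.mem_support_iff.1 hj)).trans_le hi), mul_zero, smul_zero]

/-- Monomial k expands in the columns of A H with the coefficients of row k of S̄⁻¹, which vanish
beyond k < n. -/
lemma sum_A_mul_pairing_monomialRow (hμ : HasMoments μ) (G : GaussBorel (momentMatrix μ)) {n k : ℕ}
    (hk : k < n) (x : ℂ) (a : Fin p) :
    ∑ i ∈ Finset.range n, G.A p x a i * pairing (isWeight_one hμ) (G.rowB q i) (monomialRow p k) =
      (monomialRow p k a).eval x := by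
  have h := map_act (evalEntry a x) G.lower_SbarInv.rowFinite (G.colA p) k
  rw [G.act_SbarInv_colA, evalEntry_apply, act_eq_sum (s := Finset.range n) fun i hi =>
    G.lower_SbarInv.1 _ _ (hk.trans_le (by simpa using hi))] at h
  rw [h]
  refine Finset.sum_congr rfl fun i _ => ?_
  rw [pairing_rowB_monomialRow hμ, G.A_apply, evalEntry_apply, smul_eq_mul]
  field_simp [G.h_ne_zero i]

/-- The reproducing property of the Christoffel–Darboux kernel. -/
lemma sum_A_mul_pairing (hμ : HasMoments μ) (G : GaussBorel (momentMatrix μ)) {n : ℕ}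
    {V : Fin p → ℂ[X]} (hV : IsBelow n V) (x : ℂ) (a : Fin p) :
    ∑ i ∈ Finset.range n, G.A p x a i * pairing (isWeight_one hμ) (G.rowB q i) V =
      (V a).eval x := by
  rw [eq_sum_monomialRow V]
  simp only [map_sum, map_smul, Finset.mul_sum, smul_eq_mul, mul_left_comm (G.A p x a _)]
  rw [Finset.sum_comm]
  simp only [Finset.sum_apply, Polynomial.eval_finsetSum, Pi.smul_apply, Polynomial.eval_smul]
  refine Finset.sum_congr rfl fun c _ => ?_
  rw [Finset.sum_comm]
  refine Finset.sum_congr rfl fun j hj => ?_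
  rw [← Finset.mul_sum, sum_A_mul_pairing_monomialRow hμ G
    (hV c j (Polynomial.mem_support_iff.1 hj)), smul_eq_mul]

lemma cauchyD_apply (hμ : HasMoments μ) (G : GaussBorel (momentMatrix μ)) {z : ℂ}
    (hz : z ∉ matSupport μ) (i : ℕ) (a : Fin p) :
    cauchyD G z i a = pairing (isWeight_cauchy hμ hz) (G.rowB q i) (Pi.single a 1) := by
  rw [pairing_apply, cauchyD, Matrix.of_apply]
  refine Finset.sum_congr rfl fun b _ => ?_
  rw [Finset.sum_eq_single a (fun c _ hc => by simp [Pi.single_eq_of_ne hc]) (by simp)]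
  simp only [Pi.single_eq_same, mul_one, functional_apply, GaussBorel.B_apply, div_eq_mul_inv]

/-- The column `a` of `(R(x) - R(z)) / (x - z)` as a vector of polynomials in `x`. -/
def diffQuotCol (R : Matrix (Fin p) (Fin p) ℂ[X]) (z : ℂ) (a : Fin p) : Fin p → ℂ[X] :=
  fun c => R c a /ₘ (Polynomial.X - Polynomial.C z)

lemma eval_diffQuotCol (R : Matrix (Fin p) (Fin p) ℂ[X]) (x z : ℂ) (c a : Fin p) :
    (diffQuotCol R z a c).eval x = diffQuot R x z c a := by
  have h : ∀ t, (R c a).eval t = (t - z) * (diffQuotCol R z a c).eval t + (R c a).eval z := by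
    intro t
    have h1 := congrArg (Polynomial.eval t)
      (Polynomial.modByMonic_add_div (R c a) (Polynomial.X - Polynomial.C z))
    simp only [Polynomial.modByMonic_X_sub_C_eq_C_eval, Polynomial.eval_add, Polynomial.eval_mul,
      Polynomial.eval_sub, Polynomial.eval_X, Polynomial.eval_C] at h1
    rw [← h1, diffQuotCol, add_comm]
  have hd : ∀ x, x ≠ z → (diffQuotCol R z a c).eval x = diffQuot R x z c a := fun x hx => by
    rw [diffQuot, Matrix.of_apply, dslope_of_ne _ hx, slope_def_field, h x]
    field_simp [sub_ne_zero.2 hx]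
    ring
  by_cases hx : x = z
  -- On the diagonal, the derivative of (t - x) Q(t) at t = x is Q(x).
  · subst hx
    have h2 : HasDerivAt (fun t => (R c a).eval t) ((diffQuotCol R x a c).eval x) x := by
      rw [show (fun t => (R c a).eval t) =
        fun t => (t - x) * (diffQuotCol R x a c).eval t + (R c a).eval x from funext h]
      have h3 := (((hasDerivAt_id x).sub_const x).mul
        ((diffQuotCol R x a c).hasDerivAt x)).add_const ((R c a).eval x)
      simpa using h3
    rw [diffQuot, Matrix.of_apply, dslope_same, h2.deriv]
  · exact hd x hx

end GaussBorel

/-! ### The connection matrix -/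

section Connection

variable {p q : ℕ} [NeZero q] {M Mt : Matrix ℕ ℕ ℂ}

lemma connection_rowFinite (G : GaussBorel M) (Gt : GaussBorel Mt)
    (L : Matrix (Fin q) (Fin q) ℂ[X]) : RowFinite (connection G Gt L) :=
  (Gt.lower_S.rowFinite.infMul (polyShift_rowFinite L)).infMul G.lower_Sinv.rowFinite

lemma act_connection_rowB (G : GaussBorel M) (Gt : GaussBorel Mt)
    (L : Matrix (Fin q) (Fin q) ℂ[X]) (i : ℕ) :
    act (connection G Gt L) (G.rowB q) i = Matrix.vecMul (Gt.rowB q i) L := by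
  have h1 : act (polyShift L) (monomialRow q) =
      fun k => ((Matrix.vecMulLinear L).restrictScalars ℂ) (monomialRow q k) :=
    funext fun k => act_polyShift L k
  rw [connection, act_infMul (Gt.lower_S.rowFinite.infMul (polyShift_rowFinite L))
    G.lower_Sinv.rowFinite, G.act_Sinv_rowB, act_infMul Gt.lower_S.rowFinite
    (polyShift_rowFinite L), h1, ← map_act _ Gt.lower_S.rowFinite]
  rfl

lemma infMul_connection_B (G : GaussBorel M) (Gt : GaussBorel Mt)
    (L : Matrix (Fin q) (Fin q) ℂ[X]) (y : ℂ) (i : ℕ) (b : Fin q) :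
    ∑ᶠ k, connection G Gt L i k * G.B q y k b = ∑ c, Gt.B q y i c * evalMat L y c b := by
  have h := map_act (evalEntry b y) (connection_rowFinite G Gt L) (G.rowB q) i
  rw [act_connection_rowB, evalEntry_apply, Matrix.vecMul, dotProduct,
    Polynomial.eval_finsetSum] at h
  simp only [Polynomial.eval_mul, evalEntry_apply, act, smul_eq_mul, ← GaussBorel.B_apply] at h
  exact h.symm

variable {μ μt : Matrix (Fin q) (Fin p) (ComplexMeasure ℂ)}
  {L : Matrix (Fin q) (Fin q) ℂ[X]} {R : Matrix (Fin p) (Fin p) ℂ[X]}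

/-- The connection matrix in terms of the right perturber. -/
lemma connection_mul_h (hμ : HasMoments μ) (hμt : HasMoments μt)
    (hpert : IsUvarovPerturbation μ μt L R) (G : GaussBorel (momentMatrix μ))
    (Gt : GaussBorel (momentMatrix μt)) (i k : ℕ) :
    connection G Gt L i k * G.h k =
      pairing (isWeight_one hμt) (Gt.rowB q i) (R.mulVec (G.colA p k)) := by
  have h := map_act ((pairing (isWeight_one hμ)).flip (G.colA p k)) (connection_rowFinite G Gt L)
    (G.rowB q) i
  simp only [LinearMap.flip_apply, pairing_rowB_colA hμ] at h
  rw [pairing_perturbation hμ hμt hpert (isWeight_one hμ), ← act_connection_rowB, h, act,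
    finsum_eq_single _ k fun l hl => by simp [hl]]
  simp

/-- Each column pairs B̃_i with a fixed polynomial vector, to which all B̃_i of large index are
orthogonal. -/
lemma connection_colFinite (hμ : HasMoments μ) (hμt : HasMoments μt)
    (hpert : IsUvarovPerturbation μ μt L R) (G : GaussBorel (momentMatrix μ))
    (Gt : GaussBorel (momentMatrix μt)) : RowFinite (connection G Gt L).transpose := fun k => by
  obtain ⟨n, hn⟩ := exists_isBelow (R.mulVec (G.colA p k))
  refine (Set.finite_Iio n).subset fun i hi => ?_
  by_contra h
  have := connection_mul_h hμ hμt hpert G Gt i k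
  rw [pairing_rowB_eq_zero hμt Gt hn (not_lt.1 h)] at this
  exact hi ((mul_eq_zero.1 this).resolve_right (G.h_ne_zero k))

/-- The identity Ã Ω = R A: the perturbed kernel reproduces R times column k of A H, with a
truncation n depending on k. -/
lemma A_infMul_connection (hμ : HasMoments μ) (hμt : HasMoments μt)
    (hpert : IsUvarovPerturbation μ μt L R) (G : GaussBorel (momentMatrix μ))
    (Gt : GaussBorel (momentMatrix μt)) (x : ℂ) (a : Fin p) (k : ℕ) :
    ∑ᶠ i, Gt.A p x a i * connection G Gt L i k = ∑ c, evalMat R x a c * G.A p x c k := by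
  obtain ⟨n, hn⟩ := exists_isBelow (R.mulVec (G.colA p k))
  have h1 : ∀ i, connection G Gt L i k =
      (G.h k)⁻¹ * pairing (isWeight_one hμt) (Gt.rowB q i) (R.mulVec (G.colA p k)) := fun i => by
    rw [← connection_mul_h hμ hμt hpert]
    field_simp [G.h_ne_zero k]
  rw [finsum_eq_sum_of_support_subset (s := Finset.range n) _ fun i hi => by
    by_contra h
    exact hi (by
      simp only
      rw [h1, pairing_rowB_eq_zero hμt Gt hn (by simpa using h), mul_zero, mul_zero])]
  simp only [h1, mul_left_comm (Gt.A p x a _)]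
  rw [← Finset.mul_sum, sum_A_mul_pairing hμt Gt hn]
  simp only [Matrix.mulVec, dotProduct, Polynomial.eval_finsetSum, Polynomial.eval_mul,
    Finset.mul_sum, GaussBorel.A_apply, evalMat, Matrix.map_apply]
  exact Finset.sum_congr rfl fun c _ => by ring

/-- The action of the connection matrix on the second kind functions. -/
lemma infMul_connection_cauchyD (hμ : HasMoments μ) (hμt : HasMoments μt)
    (hpert : IsUvarovPerturbation μ μt L R) (G : GaussBorel (momentMatrix μ))
    (Gt : GaussBorel (momentMatrix μt)) {z : ℂ} (hz : z ∉ matSupport μ) (hzt : z ∉ matSupport μt)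
    (i : ℕ) (a : Fin p) :
    ∑ᶠ k, connection G Gt L i k * cauchyD G z k a =
      ∑ c, cauchyD Gt z i c * evalMat R z c a -
        pairing (isWeight_one hμt) (Gt.rowB q i) (diffQuotCol R z a) := by
  have h := map_act ((pairing (isWeight_cauchy hμ hz)).flip (Pi.single a 1))
    (connection_rowFinite G Gt L) (G.rowB q) i
  simp only [LinearMap.flip_apply, ← cauchyD_apply hμ _ hz] at h
  -- Division by x - z: the constant part R(z) yields D̃(z) R(z), and the factor z - x of the rest
  -- cancels the Cauchy kernel.
  have hR : R.mulVec (Pi.single a 1) = (∑ c, (R c a).eval z • (Pi.single c 1 : Fin p → ℂ[X])) -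
      fun c => (Polynomial.C z - Polynomial.X) * diffQuotCol R z a c := by
    ext1 c
    have h1 := Polynomial.modByMonic_add_div (R c a) (Polynomial.X - Polynomial.C z)
    rw [Polynomial.modByMonic_X_sub_C_eq_C_eval] at h1
    simp only [Matrix.mulVec_single_one, Matrix.col_apply, Pi.sub_apply, Finset.sum_apply,
      Pi.smul_apply, diffQuotCol]
    rw [Finset.sum_eq_single c (fun d _ hd => by simp [Pi.single_eq_of_ne hd.symm]) (by simp)]
    nth_rewrite 1 [← h1]
    rw [Pi.single_eq_same, Polynomial.smul_eq_C_mul]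
    ring
  have h2 : ∑ᶠ k, connection G Gt L i k * cauchyD G z k a =
      pairing (isWeight_cauchy hμ hz) (act (connection G Gt L) (G.rowB q) i) (Pi.single a 1) :=
    h.symm
  rw [h2, act_connection_rowB, ← pairing_perturbation hμ hμt hpert _ (isWeight_cauchy hμt hzt),
    hR, map_sub, pairing_cauchy_smul hμt hzt, map_sum]
  simp only [map_smul, ← cauchyD_apply hμt _ hzt, smul_eq_mul, evalMat, Matrix.map_apply, mul_comm]

end Connection

/-! ### The number of eigenvalues of the right perturber -/

section Eigenvalues

lemma coeff_det_of_natDegree_le {p N : ℕ} {A : Matrix (Fin p) (Fin p) ℂ[X]}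
    (hA : ∀ i j, (A i j).natDegree ≤ N) :
    A.det.coeff (p * N) = (Matrix.of fun i j => (A i j).coeff N).det := by
  simp only [Matrix.det_apply', Polynomial.finsetSum_coeff, Polynomial.coeff_intCast_mul,
    Matrix.of_apply]
  refine Finset.sum_congr rfl fun σ _ => ?_
  have h := Polynomial.coeff_prod_of_natDegree_le (s := Finset.univ) (fun i => A (σ i) i) N
    fun i _ => hA _ _
  rw [Finset.card_univ, Fintype.card_fin] at h
  rw [h]

namespace IsRightPerturber

variable {p N r : ℕ} {R : Matrix (Fin p) (Fin p) ℂ[X]}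

lemma coeff_eq_zero (hR : IsRightPerturber R N r) {i : Fin p} (hi : p - r ≤ i) (j : Fin p) {k : ℕ}
    (hk : N ≤ k) : (R i j).coeff k = 0 := by
  rcases hk.eq_or_lt with rfl | hk
  · rw [hR.leading, if_neg]
    have := hR.lt
    omega
  · exact Polynomial.coeff_eq_zero_of_natDegree_lt ((hR.degree_le i j).trans_lt hk)

/-- The powers of `x` making all rows of the perturber of the same degree. -/
def rowShift (p r : ℕ) : Fin p → ℂ[X] := fun i => if p - r ≤ (i : ℕ) then Polynomial.X else 1

lemma natDegree_prod_rowShift (hr : r < p) : (∏ i, rowShift p r i).natDegree ≤ r := by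
  refine (Polynomial.natDegree_prod_le _ _).trans ?_
  have h : ∀ i : Fin p, (rowShift p r i).natDegree = if p - r ≤ (i : ℕ) then 1 else 0 := by
    intro i
    rw [rowShift]
    split_ifs <;> simp
  simp only [h]
  rw [Fin.sum_univ_eq_sum_range (fun i => if p - r ≤ i then 1 else 0), Finset.sum_boole]
  have : (Finset.range p).filter (fun i => p - r ≤ i) ⊆ Finset.Ico (p - r) p := fun i hi => by
    simpa [and_comm] using hi
  calc _ ≤ (Finset.Ico (p - r) p).card := by exact_mod_cast Finset.card_le_card this
    _ = r := by rw [Nat.card_Ico]; omega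

lemma natDegree_rowShift_mul_le (hR : IsRightPerturber R N r) (hN : 1 ≤ N) (i j : Fin p) :
    (rowShift p r i * R i j).natDegree ≤ N := by
  rw [rowShift]
  split_ifs with hi
  · refine Polynomial.natDegree_mul_le.trans ?_
    have : (R i j).natDegree ≤ N - 1 := Polynomial.natDegree_le_iff_coeff_eq_zero.2 fun k hk =>
      hR.coeff_eq_zero hi j (by omega)
    rw [Polynomial.natDegree_X]
    omega
  · rw [one_mul]
    exact hR.degree_le i j

/-- After the shift the leading matrix is [0, I_{p-r}; I_r, *]. On a kernel vector the top rows kill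
the entries from r on, then the bottom rows kill the others. -/
lemma det_leading_ne_zero (hR : IsRightPerturber R N r) (hN : 1 ≤ N) :
    (Matrix.of fun i j => (rowShift p r i * R i j).coeff N).det ≠ 0 := by
  intro h0
  obtain ⟨v, hv0, hv⟩ := Matrix.exists_mulVec_eq_zero_iff.2 h0
  have hr := hR.lt
  obtain ⟨m, rfl⟩ : ∃ m, N = m + 1 := ⟨N - 1, by omega⟩
  have hrow : ∀ i, ∑ j, (rowShift p r i * R i j).coeff (m + 1) * v j = 0 := fun i =>
    congrFun hv i
  have h1 : ∀ j : Fin p, r ≤ (j : ℕ) → v j = 0 := by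
    intro j hj
    have hi : ¬ p - r ≤ (j : ℕ) - r := by omega
    have := hrow ⟨j - r, by omega⟩
    simp only [rowShift, hi, if_false, one_mul, hR.leading] at this
    rw [Finset.sum_eq_single j] at this
    · simpa [Nat.sub_add_cancel hj] using this
    · intro k _ hk
      have : (k : ℕ) ≠ j - r + r := fun h => hk (Fin.ext (by omega))
      simp [this]
    · simp
  refine hv0 (funext fun j => ?_)
  by_cases hj : r ≤ (j : ℕ)
  · exact h1 j hj
  · have hi : p - r ≤ (j : ℕ) + (p - r) := by omega
    have := hrow ⟨j + (p - r), by omega⟩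
    simp only [rowShift, hi, if_true, Polynomial.coeff_X_mul] at this
    rw [Finset.sum_eq_single j] at this
    · rw [hR.subleading m rfl _ _ hi (by omega)] at this
      simpa using this
    · intro k _ hk
      by_cases hkr : r ≤ (k : ℕ)
      · rw [h1 k hkr, mul_zero]
      · rw [hR.subleading m rfl _ _ hi (by omega), if_neg, zero_mul]
        intro h
        exact hk (Fin.ext (by simp only at h; omega))
    · simp

/-- Shifting the last r rows adds at most r to deg det R and brings the degree to at least pN. -/
lemma le_numEigenvalues (hR : IsRightPerturber R N r) (hN : 1 ≤ N) :
    p * N ≤ numEigenvalues R + r := by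
  have h1 : (Matrix.of fun i j => rowShift p r i * R i j).det = (∏ i, rowShift p r i) * R.det :=
    Matrix.det_mul_column _ _
  have h2 : p * N ≤ ((∏ i, rowShift p r i) * R.det).natDegree := by
    rw [← h1]
    refine Polynomial.le_natDegree_of_ne_zero ?_
    rw [coeff_det_of_natDegree_le (A := Matrix.of fun i j => rowShift p r i * R i j)
      (hR.natDegree_rowShift_mul_le hN)]
    exact hR.det_leading_ne_zero hN
  have h3 : numEigenvalues R = R.det.natDegree :=
    (IsAlgClosed.splits R.det).natDegree_eq_card_roots.symm
  calc p * N ≤ _ := h2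
    _ ≤ _ := Polynomial.natDegree_mul_le
    _ ≤ r + R.det.natDegree := by gcongr; exact natDegree_prod_rowShift hR.lt
    _ = _ := by rw [h3, add_comm]

/-- Component c of the quotient has degree at most N - 1 for c < p - r and at most N - 2 for the
last r components. All positions jp + c are therefore below pN - r. -/
lemma isBelow_diffQuotCol (hR : IsRightPerturber R N r) {n : ℕ} (hn : numEigenvalues R ≤ n)
    (z : ℂ) (a : Fin p) : IsBelow n (diffQuotCol R z a) := by
  intro c j hj
  rw [diffQuotCol, Polynomial.coeff_divByMonic_X_sub_C] at hj
  obtain ⟨i, hi, h⟩ := Finset.exists_ne_zero_of_sum_ne_zero hj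
  have hji := (Finset.mem_Icc.1 hi).1
  have hiN : i ≤ N := (Finset.mem_Icc.1 hi).2.trans (hR.degree_le c a)
  have hr := hR.lt
  -- A nonzero quotient coefficient forces N ≥ j + 1, so N = 0 does not occur here.
  have hE := hR.le_numEigenvalues (by omega)
  by_cases hc : p - r ≤ (c : ℕ)
  · have hi' : i < N := by
      by_contra h'
      exact right_ne_zero_of_mul h (hR.coeff_eq_zero hc a (not_lt.1 h'))
    have : p * (j + 2) ≤ p * N := Nat.mul_le_mul_left p (by omega)
    have := c.isLt
    nlinarith
  · have : p * (j + 1) ≤ p * N := Nat.mul_le_mul_left p (by omega)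
    rw [mul_add, mul_one, mul_comm p j] at this
    omega

end IsRightPerturber

end Eigenvalues

/-! ### The perturbed kernels -/

lemma infMul_infMul_apply {p s : ℕ} (P : Matrix (Fin p) ℕ ℂ) (C : Matrix ℕ ℕ ℂ)
    (Q : Matrix ℕ (Fin s) ℂ) (a : Fin p) (b : Fin s) :
    infMul (infMul P C) Q a b = ∑ᶠ l, (∑ᶠ k, P a k * C k l) * Q l b := rfl

end Uvarov

end

theorem mainTheorem8 {p q : ℕ} [NeZero p] [NeZero q]
    (μ : Matrix (Fin q) (Fin p) (MeasureTheory.ComplexMeasure ℝ))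
    (μt : Matrix (Fin q) (Fin p) (MeasureTheory.ComplexMeasure ℂ))
    (hμ : Uvarov.HasMoments (Uvarov.onComplex μ)) (hμt : Uvarov.HasMoments μt)
    (L : Matrix (Fin q) (Fin q) (Polynomial ℂ)) (R : Matrix (Fin p) (Fin p) (Polynomial ℂ))
    (NL l NR r : ℕ) (hL : Uvarov.IsLeftPerturber L NL l) (hR : Uvarov.IsRightPerturber R NR r)
    (hpert : Uvarov.IsUvarovPerturbation (Uvarov.onComplex μ) μt L R)
    (G : Uvarov.GaussBorel (Uvarov.momentMatrix (Uvarov.onComplex μ)))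
    (Gt : Uvarov.GaussBorel (Uvarov.momentMatrix μt))
    (n : ℕ) (hn : 1 ≤ n) :
    -- the products with the commutator below are finite sums
    {ij : ℕ × ℕ | Uvarov.commutator (Uvarov.connection G Gt L) (Uvarov.proj (n - 1))
      ij.1 ij.2 ≠ 0}.Finite ∧
    (∀ x y : ℂ,
      Uvarov.cdKernel Gt (n - 1) x y * Uvarov.evalMat L y =
        Uvarov.evalMat R x * Uvarov.cdKernel G (n - 1) x y -
          Uvarov.infMul (Uvarov.infMul (Gt.A p x)
            (Uvarov.commutator (Uvarov.connection G Gt L) (Uvarov.proj (n - 1)))) (G.B q y)) ∧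
    (Uvarov.numEigenvalues R ≤ n →
      ∀ x y : ℂ, y ∉ Uvarov.matSupport (Uvarov.onComplex μ) → y ∉ Uvarov.matSupport μt →
        Uvarov.mixedKernel Gt (n - 1) x y * Uvarov.evalMat R y =
          Uvarov.evalMat R x * Uvarov.mixedKernel G (n - 1) x y -
            Uvarov.infMul (Uvarov.infMul (Gt.A p x)
              (Uvarov.commutator (Uvarov.connection G Gt L) (Uvarov.proj (n - 1))))
              (Uvarov.cauchyD G y) +
            Uvarov.diffQuot R x y) := by
  have hr := Uvarov.connection_rowFinite G Gt L
  have hc := Uvarov.connection_colFinite hμ hμt hpert G Gt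
  refine ⟨Uvarov.commutator_proj_finite hr hc hn, fun x y => ?_, fun hnE x y hy hyt => ?_⟩
  · ext a b
    rw [Matrix.sub_apply, Uvarov.infMul_infMul_apply, Uvarov.finsum_commutator_proj hr hc hn]
    simp only [Uvarov.A_infMul_connection hμ hμt hpert, Uvarov.infMul_connection_B,
      Matrix.mul_apply, Uvarov.cdKernel, Matrix.of_apply, Nat.sub_add_cancel hn, Finset.sum_mul,
      Finset.mul_sum]
    rw [Finset.sum_comm (s := Finset.univ), Finset.sum_comm (s := Finset.univ)]
    simp only [mul_assoc]
    ring
  · ext a b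
    -- The bound n ≥ M^R serves only here: the truncated perturbed kernel reproduces the difference
    -- quotient exactly.
    have hrep := Uvarov.sum_A_mul_pairing hμt Gt (hR.isBelow_diffQuotCol hnE y b) x a
    rw [Uvarov.eval_diffQuotCol] at hrep
    rw [Matrix.add_apply, Matrix.sub_apply, Uvarov.infMul_infMul_apply,
      Uvarov.finsum_commutator_proj hr hc hn]
    simp only [Uvarov.A_infMul_connection hμ hμt hpert,
      Uvarov.infMul_connection_cauchyD hμ hμt hpert G Gt hy hyt, mul_sub, Finset.sum_sub_distrib,
      hrep, Matrix.mul_apply, Uvarov.mixedKernel, Matrix.of_apply, Nat.sub_add_cancel hn,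
      Finset.sum_mul, Finset.mul_sum]
    rw [Finset.sum_comm (s := Finset.univ), Finset.sum_comm (s := Finset.univ)]
    simp only [mul_assoc]
    ring
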